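/- Let $V$ be a finite set of $n$ vertices, let $\{V_0,V_1\}$ be a partition of $V$ into the positions of Players $0$ and $1$ (one part may be empty), let $E\subseteq V\times V$ be an edge relation such that every vertex has a successor, and let $\Omega\colon V\to\mathbb N$ be a coloring and $w\colon E\to\mathbb Z$ a weighting. Let $\mathcal G$ be the parity game with weights given by these data. A play is an infinite path $\rho=v_0v_1v_2\cdots$ in $(V,E)$. A strategy for Player $i$ is a map $\sigma\colon V^*V_i\to V$ with $(v,\sigma(xv))\in E$ for all $xv\in V^*V_i$; $\rho$ is consistent with $\sigma$ if $v_{j+1}=\sigma(v_0\cdots v_j)$ whenever $v_j\in V_i$. For a play $\rho$ and $j\in\mathbb N$ let \[\mathrm{Cor}(\rho,j)=\min\Big\{\max_{j\le k\le j'}\Big|\sum_{i=j}^{k-1}w(v_i,v_{i+1})\Big| \;:\; j'\ge j,\ \Omega(v_{j'})\ge\Omega(v_j),\ \Omega(v_{j'})\text{ even}\Big\},\qquad \min\emptyset=\infty .\] For a strategy $\sigma$ for Player $0$ and a vertex $v$ let $\mathrm{Cost}_v(\sigma)=\sup_\rho\limsup_{j\to\infty}\mathrm{Cor}(\rho,j)\in\mathbb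 N\cup\{\infty\}$, where $\rho$ ranges over the plays that start in $v$ and are consistent with $\sigma$. Fix $b\in\mathbb N$. Let $D$ be the set of odd colors occurring in $\mathcal G$, let $I=\{(l,h)\in\mathbb Z^2: -b\le l\le h\le b\}$, let $R$ be the set of request functions $r\colon D\to\{\bot\}\cup I$, and let $M=\{0,\dots,n\}\times R$. Put $\mathrm{init}(v)=(0,r_v)$, where $r_v(c)=(0,0)$ if $\Omega(v)$ is odd and $c=\Omega(v)$, and $r_v(c)=\bot$ otherwise. For $m=(o,r)\in M$ and $(v,v')\in E$ let $\mathrm{upd}(m,(v,v'))=(o',r')$ be obtained by the following three steps. 1. (Weight) Set $r_I(c)=(l+w(v,v'),\,h+w(v,v'))$ if $r(c)=(l,h)$, and $r_I(c)=\bot$ if $r(c)=\bot$. 2. (Overflow) If there is a color $c$ with $r_I(c)=(l,h)$ and $l<-b$ or $h>b$, set $r_{II}(c)=\bot$ for all $c\in D$ and $o'=\min(o+1,n)$; otherwise set $r_{II}=r_I$ and $o'=o$. 3. (Request) If $\Omega(v')$ is even, set $r'(c)=\bot$ for $c\le\Omega(v')$ and $r'(c)=r_{II}(c)$ for all other $c$.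 If $\Omega(v')$ is odd, set $r'(c)=r_{II}(c)$ for $c\ne\Omega(v')$, and for $c=\Omega(v')$ set $r'(c)=(\min\{l,0\},\max\{h,0\})$ if $r_{II}(c)=(l,h)$ and $r'(c)=(0,0)$ if $r_{II}(c)=\bot$. The threshold game $\mathcal G_b$ is the classical parity game with vertex set $V\times M$, in which $V_i\times M$ are the positions of Player $i$, there is an edge from $(v,m)$ to $(v',m')$ if and only if $(v,v')\in E$ and $\mathrm{upd}(m,(v,v'))=m'$, and the color of $(v,o,r)$ is $\Omega(v)$ if $o<n$ and $1$ if $o=n$. Player $0$ wins a play of $\mathcal G_b$ if and only if almost all occurrences of an odd color are followed by a larger even color. Player $0$ wins $\mathcal G_b$ from a vertex if he has a strategy such that he wins every play that starts in that vertex and is consistent with the strategy. Then for every $b\in\mathbb N$ and every vertex $v^*\in V$, Player $0$ has a strategy $\sigma$ in $\mathcal G$ with $\mathrm{Cost}_{v^*}(\sigma)\le b$ if and only if Player $0$ wins $\mathcal G_b$ from $(v^*,\mathrm{init}(v^*))$. -/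

import Mathlib

open Filter

namespace WeightedParity

/-! ### Arenas, plays, strategies, games -/

/-- An arena: a finite directed graph without terminal vertices, together with a partition of its
vertices into the positions of Player `0` and the positions of Player `1`
(`V_i = {v | owner v = i}`). -/
structure Arena (V : Type*) where
  /-- the player who moves at a vertex -/
  owner : V → Fin 2
  /-- the edge relation -/
  edge : V → V → Prop
  finite : Finite V
  exists_edge : ∀ v, ∃ v', edge v v'

variable {V : Type*}

/-- `ρ` is a play: an infinite path through the graph. -/
def Arena.IsPlay (A : Arena V) (ρ : ℕ → V) : Prop :=
  ∀ j, A.edge (ρ j) (ρ (j + 1))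

/-- A strategy for Player `i`, i.e. a map `V^* V_i → V` that follows edges. The value
`move w v` is the vertex chosen after the history `w v`; it is irrelevant when `v` does not belong
to Player `i`. -/
structure Strategy (A : Arena V) (i : Fin 2) where
  move : List V → V → V
  edge_move : ∀ w v, A.owner v = i → A.edge v (move w v)

/-- `ρ` is consistent with `σ`: whenever `ρ j` is a position of Player `i`, the next vertex is the
one that `σ` chooses after the history `ρ 0, …, ρ (j-1), ρ j`. -/
def Strategy.Consistent {A : Arena V} {i : Fin 2} (σ : Strategy A i) (ρ : ℕ → V) : Prop :=
  ∀ j, A.owner (ρ j) = i → ρ (j + 1) = σ.move ((List.range j).map ρ) (ρ j)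

/-- A game: an arena and the set of sequences that are winning for Player `0`. -/
structure Game (V : Type*) where
  arena : Arena V
  win : Set (ℕ → V)

/-- The set of sequences that are winning for Player `i`. -/
def Game.winFor (G : Game V) (i : Fin 2) : Set (ℕ → V) :=
  if i = 0 then G.win else G.winᶜ

/-- Player `i` wins `G` from `v`: he has a strategy such that every play that starts in `v` and is
consistent with it is won by Player `i`. -/
def Game.Wins (G : Game V) (i : Fin 2) (v : V) : Prop :=
  ∃ σ : Strategy G.arena i, ∀ ρ : ℕ → V,
    G.arena.IsPlay ρ → ρ 0 = v → σ.Consistent ρ → ρ ∈ G.winFor i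

/-! ### Parity conditions, with and without weights -/

/-- The colors that answer a request for color `c`. -/
def answer (c : ℕ) : Set ℕ :=
  {c' | c ≤ c' ∧ Even c'}

/-- The classical (max-)parity condition: almost all occurrences of odd colors are answered by a
later occurrence of a larger even color. -/
def parity (Ω : V → ℕ) : Set (ℕ → V) :=
  {ρ | ∀ᶠ j in atTop, Odd (Ω (ρ j)) → ∃ j', j ≤ j' ∧ Ω (ρ j') ∈ answer (Ω (ρ j))}

/-- The accumulated weight of the infix `ρ j ⋯ ρ k`, for `j ≤ k`. -/
def infixWeight (w : V → V → ℤ) (ρ : ℕ → V) (j k : ℕ) : ℤ :=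
  ∑ i ∈ Finset.Ico j k, w (ρ i) (ρ (i + 1))

/-- The amplitude of the infix `ρ j ⋯ ρ j'`: the largest absolute value of the accumulated weight
of one of its nonempty prefixes. -/
def amplitude (w : V → V → ℤ) (ρ : ℕ → V) (j j' : ℕ) : ℕ :=
  (Finset.Icc j j').sup fun k => (infixWeight w ρ j k).natAbs

/-- The cost-of-response at position `j` of `ρ`: the minimum of the amplitudes of the infixes that
start at `j` and end at an answer to the request at `j`; it is `∞` if there is no answer. -/
noncomputable def costOfResponse (Ω : V → ℕ) (w : V → V → ℤ) (ρ : ℕ → V) (j : ℕ) : ℕ∞ :=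
  ⨅ (j' : ℕ) (_ : j ≤ j' ∧ Ω (ρ j') ∈ answer (Ω (ρ j))), (amplitude w ρ j j' : ℕ∞)

/-- The parity condition with weights. -/
def weightParity (Ω : V → ℕ) (w : V → V → ℤ) : Set (ℕ → V) :=
  {ρ | limsup (fun j => costOfResponse Ω w ρ j) atTop < ⊤}

/-- The data of a parity game with weights: an arena, a coloring of its vertices and an integer
weighting of its edges. Only the values of `weight` on edges ever matter. -/
structure ParityGameWithWeights (V : Type*) where
  arena : Arena V
  color : V → ℕ
  weight : V → V → ℤ

namespace ParityGameWithWeights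

/-- The parity game with weights, as a game. -/
def toGame (G : ParityGameWithWeights V) : Game V where
  arena := G.arena
  win := weightParity G.color G.weight

/-- `Cost_v(σ)`: the supremum of `limsup_j Cor(ρ, j)` over all plays `ρ` that start in `v` and are
consistent with the strategy `σ` for Player `0`. -/
noncomputable def cost (G : ParityGameWithWeights V) (v : V) (σ : Strategy G.arena 0) : ℕ∞ :=
  ⨆ (ρ : ℕ → V) (_ : G.arena.IsPlay ρ ∧ ρ 0 = v ∧ σ.Consistent ρ),
    limsup (fun j => costOfResponse G.color G.weight ρ j) atTop

/-! ### The threshold game -/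

/-- The set `D` of odd colors that occur in `G`. -/
def oddColors (G : ParityGameWithWeights V) : Set ℕ :=
  {c | Odd c ∧ ∃ v, G.color v = c}

/-- The set of intervals `(l, h)` with `-b ≤ l ≤ h ≤ b`. -/
def intervals (b : ℕ) : Set (ℤ × ℤ) :=
  {p | -(b : ℤ) ≤ p.1 ∧ p.1 ≤ p.2 ∧ p.2 ≤ (b : ℤ)}

/-- A `b`-bounded request function: a map from `D` to `{⊥} ∪ intervals b`, where `⊥` is `none`. -/
def RequestFun (G : ParityGameWithWeights V) (b : ℕ) : Type :=
  {r : G.oddColors → Option (ℤ × ℤ) // ∀ c p, r c = some p → p ∈ intervals b}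

/-- The request function `r_v`, in which exactly the request posed by `v`, if any, is open. -/
def initRequest (G : ParityGameWithWeights V) (b : ℕ) (v : V) : G.RequestFun b :=
  ⟨fun c => if Odd (G.color v) ∧ (c : ℕ) = G.color v then some (0, 0) else none, by
    intro c p h
    simp only at h
    split_ifs at h
    cases h
    simp [intervals]⟩

/-- First step of the update: the weight of the traversed edge is added to both ends of each
interval. -/
def weightStep (G : ParityGameWithWeights V) (x : ℤ) (r : G.oddColors → Option (ℤ × ℤ)) :
    G.oddColors → Option (ℤ × ℤ) :=
  fun c => (r c).map fun p => (p.1 + x, p.2 + x)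

/-- Some open request violates the bound `b`. -/
def Overflows (G : ParityGameWithWeights V) (b : ℕ) (r : G.oddColors → Option (ℤ × ℤ)) : Prop :=
  ∃ c p, r c = some p ∧ (p.1 < -(b : ℤ) ∨ (b : ℤ) < p.2)

open Classical in
/-- Second step of the update: if an overflow occurs, then all requests are deleted. -/
noncomputable def overflowStep (G : ParityGameWithWeights V) (b : ℕ)
    (r : G.oddColors → Option (ℤ × ℤ)) : G.oddColors → Option (ℤ × ℤ) :=
  if G.Overflows b r then fun _ => none else r

/-- Add the accumulated weight `0` of a new request to the interval of its color. -/
def openRequest : Option (ℤ × ℤ) → ℤ × ℤ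
  | none => (0, 0)
  | some p => (min p.1 0, max p.2 0)

/-- Third step of the update: the effect of visiting a vertex of color `k`, which answers requests
if `k` is even and poses a request if `k` is odd. -/
def requestStep (G : ParityGameWithWeights V) (k : ℕ) (r : G.oddColors → Option (ℤ × ℤ)) :
    G.oddColors → Option (ℤ × ℤ) :=
  fun c =>
    if Even k then
      if (c : ℕ) ≤ k then none else r c
    else
      if (c : ℕ) = k then some (openRequest (r c)) else r c

/-- The update of a request function along the edge from `v` to `v'`. -/
noncomputable def updRequest (G : ParityGameWithWeights V) (b : ℕ) (r : G.RequestFun b)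
    (v v' : V) : G.RequestFun b :=
  ⟨G.requestStep (G.color v') (G.overflowStep b (G.weightStep (G.weight v v') r.1)), by
    have key : ∀ c p, G.overflowStep b (G.weightStep (G.weight v v') r.1) c = some p →
        p ∈ intervals b := by
      intro c p h
      unfold overflowStep at h
      split_ifs at h with ho
      have hb : ¬ (p.1 < -(b : ℤ) ∨ (b : ℤ) < p.2) := fun hp => ho ⟨c, p, h, hp⟩
      simp only [weightStep, Option.map_eq_some_iff] at h
      obtain ⟨q, hq, rfl⟩ := h
      have := r.2 c q hq
      simp only [intervals, Set.mem_ofPred_eq] at this hb ⊢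
      omega
    intro c p h
    simp only [requestStep] at h
    split_ifs at h with h1 h2 h3
    · exact key c p h
    · cases h
      cases hr : G.overflowStep b (G.weightStep (G.weight v v') r.1) c with
      | none => simp [openRequest, intervals]
      | some q =>
        have := key c q hr
        simp only [openRequest, intervals, Set.mem_ofPred_eq] at this ⊢
        omega
    · exact key c p h⟩

/-- The memory states: an overflow counter in `{0, …, n}`, where `n` is the number of vertices,
and a request function. -/
abbrev Memory (G : ParityGameWithWeights V) (b : ℕ) : Type :=
  Fin (Nat.card V + 1) × G.RequestFun b

/-- The initial memory state `init(v)`. -/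
noncomputable def init (G : ParityGameWithWeights V) (b : ℕ) (v : V) : G.Memory b :=
  (0, G.initRequest b v)

open Classical in
/-- The update `upd(m, (v, v'))` of the memory state `m = (o, r)`: the counter is increased, up to
`n`, if an overflow occurs. -/
noncomputable def upd (G : ParityGameWithWeights V) (b : ℕ) (m : G.Memory b) (v v' : V) :
    G.Memory b :=
  (if G.Overflows b (G.weightStep (G.weight v v') m.2.1) then
      ⟨min ((m.1 : ℕ) + 1) (Nat.card V), Nat.lt_succ_of_le (min_le_right _ _)⟩
    else m.1,
   G.updRequest b m.2 v v')

theorem finite_requestFun (G : ParityGameWithWeights V) (b : ℕ) : Finite (G.RequestFun b) := by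
  have := G.arena.finite
  have hD : Finite G.oddColors :=
    ((Set.finite_range G.color).subset fun c hc => hc.2).to_subtype
  have hI : (intervals b).Finite :=
    ((Set.finite_Icc (-(b : ℤ)) b).prod (Set.finite_Icc (-(b : ℤ)) b)).subset fun p hp => by
      simp only [intervals, Set.mem_ofPred_eq] at hp
      simp only [Set.mem_prod, Set.mem_Icc]
      omega
  have hR : {r : G.oddColors → Option (ℤ × ℤ) |
      ∀ c, r c ∈ insert none (some '' intervals b)}.Finite :=
    Set.Finite.pi' fun _ => (hI.image some).insert none
  refine (hR.subset ?_).to_subtype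
  intro r hr c
  cases h : r c with
  | none => simp
  | some p => simpa using hr c p h

/-- The arena of the threshold game: the product of the arena of `G` with the memory structure
given by `init` and `upd`. -/
def thresholdArena (G : ParityGameWithWeights V) (b : ℕ) : Arena (V × G.Memory b) where
  owner x := G.arena.owner x.1
  edge x y := G.arena.edge x.1 y.1 ∧ G.upd b x.2 x.1 y.1 = y.2
  finite := by
    have := G.arena.finite
    have := G.finite_requestFun b
    infer_instance
  exists_edge x := by
    obtain ⟨v', h⟩ := G.arena.exists_edge x.1
    exact ⟨(v', G.upd b x.2 x.1 v'), h, rfl⟩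

/-- The coloring of the threshold game: vertices inherit their color from `G` as long as the
overflow counter is less than `n`, and have color `1` once it is saturated. -/
noncomputable def thresholdColor (G : ParityGameWithWeights V) (b : ℕ) (x : V × G.Memory b) : ℕ :=
  if (x.2.1 : ℕ) < Nat.card V then G.color x.1 else 1

/-- The `b`-threshold game `G_b` of `G`, a classical parity game. -/
noncomputable def thresholdGame (G : ParityGameWithWeights V) (b : ℕ) :
    Game (V × G.Memory b) where
  arena := G.thresholdArena b
  win := parity (G.thresholdColor b)

end ParityGameWithWeights

end WeightedParity

namespace WeightedParity

variable {V : Type*}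

/-! ### Histories, residual strategies and splicing of plays -/

/-! For each odd color the memory keeps an interval that contains the accumulated weights of its
open requests and whose ends are attained by such requests (`requestRun_covers`,
`exists_openRequest`). So an overflow exhibits a request of cost greater than `b`, and once
overflows cease, every answered request costs at most `b`.

If Player 0 wins the threshold game, the counter never saturates, because color `1` forever loses.
Hence overflows are finite in number, and the parity condition gives cost at most `b`
(`cost_le_of_wins`).

For the converse, a strategy `σ` of cost at most `b` may still overflow `n` times or more, so it has
to be improved. An overflow resets the memory to the initial state of the vertex reached; the past
can be forgotten there and the strategy exchanged. The sets `region b k` increase with `k`, so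
either the `n`-th one contains every vertex or `region b (k + 1) = region b k` for some `k < n`. In
the second case, suppose that the initial vertex lies outside this set. By `mem_region_succ`, from
any vertex outside it that `σ` reaches, some continuation consistent with `σ` overflows into a
vertex outside it again. Iterating, with the memory restarted each time, yields one play consistent
with `σ` that contains infinitely many requests of cost greater than `b`, a contradiction
(`mem_region_of_stable`). -/

theorem getD_map_range (ρ : ℕ → V) {i j : ℕ} (h : i ≤ j) :
    ((List.range j).map ρ).getD i (ρ j) = ρ i := by
  rcases h.lt_or_eq with h | rfl
  · simp [List.getD_eq_getElem?_getD, h]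
  · simp [List.getD_eq_getElem?_getD]

/-- The strategy that `σ` induces after the history `h`. -/
def Strategy.residual {A : Arena V} {i : Fin 2} (σ : Strategy A i) (h : List V) :
    Strategy A i where
  move w v := σ.move (h ++ w) v
  edge_move _ _ hv := σ.edge_move _ _ hv

/-- The sequence that follows `ρ` before position `m` and `π` from then on. -/
def splice (ρ : ℕ → V) (m : ℕ) (π : ℕ → V) : ℕ → V :=
  fun i => if i < m then ρ i else π (i - m)

theorem splice_add (ρ : ℕ → V) (m : ℕ) (π : ℕ → V) (i : ℕ) : splice ρ m π (m + i) = π i := by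
  simp [splice]

theorem splice_of_le {ρ : ℕ → V} {m : ℕ} {π : ℕ → V} (h0 : π 0 = ρ m) {i : ℕ} (hi : i ≤ m) :
    splice ρ m π i = ρ i := by
  rcases hi.lt_or_eq with hi | rfl
  · simp [splice, hi]
  · simp [splice, h0]

theorem map_range_splice (ρ : ℕ → V) (m : ℕ) (π : ℕ → V) (i : ℕ) :
    (List.range (m + i)).map (splice ρ m π) =
      (List.range m).map ρ ++ (List.range i).map π := by
  rw [List.range_add, List.map_append, List.map_map]
  congr 1
  · refine List.map_congr_left fun k hk => ?_
    simp [splice, List.mem_range.1 hk]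
  · refine List.map_congr_left fun k _ => ?_
    simp [splice]

theorem map_range_congr {ρ π : ℕ → V} {j : ℕ} (h : ∀ k < j, ρ k = π k) :
    (List.range j).map ρ = (List.range j).map π :=
  List.map_congr_left fun k hk => h k (List.mem_range.1 hk)

theorem isPlay_splice {A : Arena V} {ρ π : ℕ → V} {m : ℕ} (h0 : π 0 = ρ m)
    (hρ : ∀ j < m, A.edge (ρ j) (ρ (j + 1))) (hπ : A.IsPlay π) : A.IsPlay (splice ρ m π) := by
  intro j
  rcases lt_or_ge j m with hj | hj
  · rw [splice_of_le h0 hj.le, splice_of_le h0 hj]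
    exact hρ j hj
  · obtain ⟨i, rfl⟩ := Nat.exists_eq_add_of_le hj
    rw [add_assoc, splice_add, splice_add]
    exact hπ i

theorem consistent_splice {A : Arena V} {p : Fin 2} {σ : Strategy A p} {ρ π : ℕ → V} {m : ℕ}
    (h0 : π 0 = ρ m)
    (hρ : ∀ j < m, A.owner (ρ j) = p → ρ (j + 1) = σ.move ((List.range j).map ρ) (ρ j))
    (hπ : (σ.residual ((List.range m).map ρ)).Consistent π) :
    σ.Consistent (splice ρ m π) := by
  intro j
  rcases lt_or_ge j m with hj | hj
  · rw [splice_of_le h0 hj.le, splice_of_le h0 hj,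
      map_range_congr fun k hk => splice_of_le h0 (hk.le.trans hj.le)]
    exact hρ j hj
  · obtain ⟨i, rfl⟩ := Nat.exists_eq_add_of_le hj
    rw [add_assoc, splice_add, splice_add, map_range_splice]
    exact hπ i

theorem Strategy.exists_consistent {A : Arena V} {p : Fin 2} (σ : Strategy A p) (u : V) :
    ∃ π, A.IsPlay π ∧ π 0 = u ∧ σ.Consistent π := by
  classical
  let next : List V → V → V := fun w v =>
    if A.owner v = p then σ.move w v else (A.exists_edge v).choose
  -- The history is carried along with the current vertex, since a move depends on both.
  let H : ℕ → List V × V := fun k => Nat.rec ([], u) (fun _ x => (x.1 ++ [x.2], next x.1 x.2)) k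
  have hH : ∀ k, (H k).1 = (List.range k).map fun i => (H i).2 := by
    intro k
    induction k with
    | zero => rfl
    | succ k ih =>
      rw [List.range_succ, List.map_append, ← ih]
      rfl
  have hs : ∀ k, (H (k + 1)).2 = next (H k).1 (H k).2 := fun _ => rfl
  refine ⟨fun k => (H k).2, fun k => ?_, rfl, fun k hk => ?_⟩
  · simp only [hs, next]
    split_ifs with h
    · exact σ.edge_move _ _ h
    · exact (A.exists_edge _).choose_spec
  · simp only [hs, next]
    rw [if_pos hk, hH]

/-- A finite path that is consistent with a strategy extends to a consistent play. -/
theorem Strategy.exists_extension {A : Arena V} {p : Fin 2} (σ : Strategy A p) {ρ : ℕ → V} {m : ℕ}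
    (hρ : ∀ j < m, A.edge (ρ j) (ρ (j + 1)))
    (hc : ∀ j < m, A.owner (ρ j) = p → ρ (j + 1) = σ.move ((List.range j).map ρ) (ρ j)) :
    ∃ π, A.IsPlay π ∧ σ.Consistent π ∧ ∀ i ≤ m, π i = ρ i := by
  obtain ⟨π, h1, h2, h3⟩ := (σ.residual ((List.range m).map ρ)).exists_consistent (ρ m)
  exact ⟨splice ρ m π, isPlay_splice h2 hρ h1, consistent_splice h2 hc h3,
    fun i hi => splice_of_le h2 hi⟩

/-! ### Suffixes of plays -/

theorem parity_shift_iff (Ω : V → ℕ) (ρ : ℕ → V) (m : ℕ) :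
    (fun i => ρ (m + i)) ∈ parity Ω ↔ ρ ∈ parity Ω := by
  simp only [parity, Set.mem_ofPred_eq, eventually_atTop]
  constructor
  · rintro ⟨N, hN⟩
    refine ⟨m + N, fun j hj ho => ?_⟩
    obtain ⟨i, rfl⟩ := Nat.exists_eq_add_of_le ((Nat.le_add_right m N).trans hj)
    obtain ⟨j', h1, h2⟩ := hN i (by omega) ho
    exact ⟨m + j', by omega, h2⟩
  · rintro ⟨N, hN⟩
    refine ⟨N, fun j hj ho => ?_⟩
    obtain ⟨j', h1, h2⟩ := hN (m + j) (by omega) ho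
    refine ⟨j' - m, by omega, ?_⟩
    rwa [Nat.add_sub_cancel' (by omega)]

/-! ### Accumulated weights and bounds on the cost-of-response. -/

theorem infixWeight_self (w : V → V → ℤ) (ρ : ℕ → V) (j : ℕ) : infixWeight w ρ j j = 0 := by
  simp [infixWeight]

theorem infixWeight_succ (w : V → V → ℤ) (ρ : ℕ → V) {j k : ℕ} (h : j ≤ k) :
    infixWeight w ρ j (k + 1) = infixWeight w ρ j k + w (ρ k) (ρ (k + 1)) := by
  simp [infixWeight, Finset.sum_Ico_succ_top h]

theorem infixWeight_shift (w : V → V → ℤ) (ρ : ℕ → V) (m j k : ℕ) :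
    infixWeight w (fun i => ρ (m + i)) j k = infixWeight w ρ (m + j) (m + k) := by
  simp only [infixWeight]
  rw [add_comm m j, add_comm m k, ← Finset.sum_Ico_add]
  rfl

theorem costOfResponse_le {Ω : V → ℕ} {w : V → V → ℤ} {ρ : ℕ → V} {j j' b : ℕ} (hj : j ≤ j')
    (ha : Ω (ρ j') ∈ answer (Ω (ρ j)))
    (h : ∀ k, j ≤ k → k ≤ j' → (infixWeight w ρ j k).natAbs ≤ b) :
    costOfResponse Ω w ρ j ≤ b := by
  refine (iInf₂_le j' ⟨hj, ha⟩).trans ?_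
  rw [Nat.cast_le]
  exact Finset.sup_le fun k hk => h k (Finset.mem_Icc.1 hk).1 (Finset.mem_Icc.1 hk).2

/-- Position `t` itself may be an answer: the amplitude up to an answer at `t` already includes the
weight at `t`. -/
theorem lt_costOfResponse {Ω : V → ℕ} {w : V → V → ℤ} {ρ : ℕ → V} {j t b : ℕ} (hj : j ≤ t)
    (ha : ∀ k, j ≤ k → k < t → Ω (ρ k) ∉ answer (Ω (ρ j)))
    (h : b < (infixWeight w ρ j t).natAbs) :
    (b : ℕ∞) < costOfResponse Ω w ρ j := by
  have h1 : ((b + 1 : ℕ) : ℕ∞) ≤ costOfResponse Ω w ρ j := by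
    refine le_iInf₂ fun j' hj' => ?_
    rw [Nat.cast_le]
    have ht : t ≤ j' := not_lt.1 fun hlt => ha j' hj'.1 hlt hj'.2
    exact h.trans_le (Finset.le_sup (f := fun k => (infixWeight w ρ j k).natAbs)
      (Finset.mem_Icc.2 ⟨hj, ht⟩))
  exact lt_of_lt_of_le (by exact_mod_cast Nat.lt_succ_self b) h1

theorem exists_answer_of_costOfResponse_lt_top {Ω : V → ℕ} {w : V → V → ℤ} {ρ : ℕ → V} {j : ℕ}
    (h : costOfResponse Ω w ρ j < ⊤) : ∃ j', j ≤ j' ∧ Ω (ρ j') ∈ answer (Ω (ρ j)) := by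
  by_contra hn
  push Not at hn
  refine h.ne ?_
  simp only [costOfResponse, iInf_eq_top]
  exact fun j' hj' => absurd hj'.2 (hn j' hj'.1)

/-- Costs are discrete, so being eventually below `b + 1` means being eventually at most `b`. -/
theorem eventually_costOfResponse_le {Ω : V → ℕ} {w : V → V → ℤ} {ρ : ℕ → V} {b : ℕ}
    (h : limsup (fun j => costOfResponse Ω w ρ j) atTop ≤ (b : ℕ∞)) :
    ∀ᶠ j in atTop, costOfResponse Ω w ρ j ≤ b := by
  have h1 : limsup (fun j => costOfResponse Ω w ρ j) atTop < ((b + 1 : ℕ) : ℕ∞) :=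
    lt_of_le_of_lt h (by exact_mod_cast Nat.lt_succ_self b)
  filter_upwards [eventually_lt_of_limsup_lt h1] with j hj
  exact Order.le_of_lt_add_one (by exact_mod_cast hj)

namespace ParityGameWithWeights

variable (G : ParityGameWithWeights V) (b : ℕ)

/-! ### The run of the memory structure on a sequence of vertices -/

/-- The request functions along `ρ`, when the memory is initialized at position `0`. -/
noncomputable def requestRun (ρ : ℕ → V) : ℕ → G.RequestFun b
  | 0 => G.initRequest b (ρ 0)
  | k + 1 => G.updRequest b (requestRun ρ k) (ρ k) (ρ (k + 1))

/-- The memory states along `ρ`, when the memory is initialized at position `0`. -/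
noncomputable def memoryRun (ρ : ℕ → V) : ℕ → G.Memory b
  | 0 => G.init b (ρ 0)
  | k + 1 => G.upd b (memoryRun ρ k) (ρ k) (ρ (k + 1))

/-- The step of `ρ` from position `t` to position `t + 1` causes an overflow. -/
def OverflowAt (ρ : ℕ → V) (t : ℕ) : Prop :=
  G.Overflows b (G.weightStep (G.weight (ρ t) (ρ (t + 1))) (G.requestRun b ρ t).1)

variable {G b}

theorem memoryRun_snd (ρ : ℕ → V) (k : ℕ) : (G.memoryRun b ρ k).2 = G.requestRun b ρ k := by
  induction k with
  | zero => rfl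
  | succ k ih => simp only [memoryRun, requestRun, upd, ih]

theorem memoryRun_congr {ρ ρ' : ℕ → V} {k : ℕ} (h : ∀ i ≤ k, ρ i = ρ' i) :
    G.memoryRun b ρ k = G.memoryRun b ρ' k := by
  induction k with
  | zero => simp only [memoryRun, h 0 le_rfl]
  | succ k ih =>
    simp only [memoryRun]
    rw [ih fun i hi => h i (hi.trans k.le_succ), h k k.le_succ, h (k + 1) le_rfl]

theorem requestRun_congr {ρ ρ' : ℕ → V} {k : ℕ} (h : ∀ i ≤ k, ρ i = ρ' i) :
    G.requestRun b ρ k = G.requestRun b ρ' k := by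
  rw [← memoryRun_snd, ← memoryRun_snd, memoryRun_congr h]

theorem overflowAt_congr {ρ ρ' : ℕ → V} {t : ℕ} (h : ∀ i ≤ t + 1, ρ i = ρ' i) :
    G.OverflowAt b ρ t ↔ G.OverflowAt b ρ' t := by
  simp only [OverflowAt]
  rw [requestRun_congr fun i hi => h i (hi.trans t.le_succ), h t t.le_succ, h (t + 1) le_rfl]

theorem overflowStep_of_overflows {r : G.oddColors → Option (ℤ × ℤ)} (h : G.Overflows b r) :
    G.overflowStep b r = fun _ => none := if_pos h

theorem overflowStep_of_not_overflows {r : G.oddColors → Option (ℤ × ℤ)}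
    (h : ¬ G.Overflows b r) : G.overflowStep b r = r := if_neg h

theorem requestRun_succ (ρ : ℕ → V) (k : ℕ) : (G.requestRun b ρ (k + 1)).1 =
    G.requestStep (G.color (ρ (k + 1))) (G.overflowStep b
      (G.weightStep (G.weight (ρ k) (ρ (k + 1))) (G.requestRun b ρ k).1)) := rfl

/-- After all requests are deleted, only the one posed by the new vertex remains. An overflow is
thus a restart of the memory, which is what makes switching strategies possible. -/
theorem requestRun_of_overflowAt {ρ : ℕ → V} {t : ℕ} (h : G.OverflowAt b ρ t) :
    G.requestRun b ρ (t + 1) = G.initRequest b (ρ (t + 1)) := by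
  apply Subtype.ext
  funext c
  rw [requestRun_succ, overflowStep_of_overflows h]
  simp only [requestStep, initRequest, openRequest, ← Nat.not_even_iff_odd]
  split_ifs <;> simp_all

theorem requestRun_shift {ρ : ℕ → V} {t : ℕ} (h : G.OverflowAt b ρ t) (i : ℕ) :
    G.requestRun b (fun i => ρ (t + 1 + i)) i = G.requestRun b ρ (t + 1 + i) := by
  induction i with
  | zero => exact (requestRun_of_overflowAt h).symm
  | succ i ih =>
    rw [← add_assoc]
    simp only [requestRun]
    rw [ih]
    rfl

theorem overflowAt_shift {ρ : ℕ → V} {t : ℕ} (h : G.OverflowAt b ρ t) (i : ℕ) :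
    G.OverflowAt b (fun i => ρ (t + 1 + i)) i ↔ G.OverflowAt b ρ (t + 1 + i) := by
  simp only [OverflowAt]
  rw [requestRun_shift h]
  rfl

/-- The memory keeps intervals whose ends are accumulated weights of open requests. -/
theorem exists_openRequest (ρ : ℕ → V) (k : ℕ) (c : G.oddColors) (p : ℤ × ℤ)
    (hp : (G.requestRun b ρ k).1 c = some p) (x : ℤ) (hx : x = p.1 ∨ x = p.2) :
    ∃ j ≤ k, G.color (ρ j) = c ∧ infixWeight G.weight ρ j k = x ∧
      ∀ i, j ≤ i → i ≤ k → G.color (ρ i) ∉ answer (G.color (ρ j)) := by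
  have base : ∀ k, G.color (ρ k) = c → ∃ j ≤ k, G.color (ρ j) = c ∧
      infixWeight G.weight ρ j k = 0 ∧
      ∀ i, j ≤ i → i ≤ k → G.color (ρ i) ∉ answer (G.color (ρ j)) := by
    intro k hk
    refine ⟨k, le_rfl, hk, infixWeight_self _ _ _, fun i h1 h2 => ?_⟩
    obtain rfl := le_antisymm h2 h1
    rw [hk]
    exact fun h => (Nat.not_even_iff_odd.2 c.2.1) h.2
  induction k generalizing p x with
  | zero =>
    simp only [requestRun, initRequest] at hp
    split_ifs at hp with h
    cases hp
    obtain rfl : x = 0 := by simpa using hx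
    exact base 0 h.2.symm
  | succ k ih =>
    -- An end that survives the weight step is an old end plus the edge weight, so the induction
    -- hypothesis supplies its request.
    have step : ∀ q, G.overflowStep b (G.weightStep (G.weight (ρ k) (ρ (k + 1)))
        (G.requestRun b ρ k).1) c = some q → G.color (ρ (k + 1)) ∉ answer c →
        ∀ x, (x = q.1 ∨ x = q.2) → ∃ j ≤ k + 1, G.color (ρ j) = c ∧
          infixWeight G.weight ρ j (k + 1) = x ∧
          ∀ i, j ≤ i → i ≤ k + 1 → G.color (ρ i) ∉ answer (G.color (ρ j)) := by
      intro q hq hc x hx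
      by_cases ho : G.Overflows b (G.weightStep (G.weight (ρ k) (ρ (k + 1)))
          (G.requestRun b ρ k).1)
      · simp [overflowStep_of_overflows ho] at hq
      rw [overflowStep_of_not_overflows ho] at hq
      simp only [weightStep, Option.map_eq_some_iff] at hq
      obtain ⟨q', hq', rfl⟩ := hq
      obtain ⟨j, hj, h1, h2, h3⟩ := ih q' hq' (x - G.weight (ρ k) (ρ (k + 1)))
        (by rcases hx with rfl | rfl <;> simp)
      refine ⟨j, hj.trans k.le_succ, h1, ?_, fun i hi1 hi2 => ?_⟩
      · rw [infixWeight_succ _ _ hj, h2]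
        ring
      · rcases Nat.le_succ_iff.1 hi2 with hi2 | rfl
        · exact h3 i hi1 hi2
        · rwa [h1]
    rw [requestRun_succ] at hp
    simp only [requestStep] at hp
    split_ifs at hp with he h1 h1
    · exact step p hp (fun h => h1 h.1) x hx
    · cases hp
      cases hr : G.overflowStep b (G.weightStep (G.weight (ρ k) (ρ (k + 1)))
          (G.requestRun b ρ k).1) c with
      | none =>
        rw [hr] at hx
        obtain rfl : x = 0 := by simpa [openRequest] using hx
        exact base _ h1.symm
      | some q =>
        rw [hr] at hx
        -- After `min` or `max` with `0`, an end belongs either to the new request or to an older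
        -- one.
        have hx' : x = 0 ∨ x = q.1 ∨ x = q.2 := by
          simp only [openRequest] at hx
          omega
        rcases hx' with rfl | hx'
        · exact base _ h1.symm
        · exact step q hr (fun h => he h.2) x hx'
    · exact step p hp (fun h => he h.2) x hx

/-- An overflow is caused by a request whose cost-of-response exceeds the bound. -/
theorem exists_lt_costOfResponse {ρ : ℕ → V} {t : ℕ} (h : G.OverflowAt b ρ t) :
    ∃ j ≤ t, (∀ i, j ≤ i → i < t + 1 → G.color (ρ i) ∉ answer (G.color (ρ j))) ∧
      b < (infixWeight G.weight ρ j (t + 1)).natAbs := by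
  obtain ⟨c, p, hp, hb⟩ := h
  simp only [weightStep, Option.map_eq_some_iff] at hp
  obtain ⟨q, hq, rfl⟩ := hp
  rcases hb with hb | hb
  · obtain ⟨j, hj, -, h2, h3⟩ := exists_openRequest ρ t c q hq q.1 (Or.inl rfl)
    refine ⟨j, hj, fun i h4 h5 => h3 i h4 (by omega), ?_⟩
    rw [infixWeight_succ _ _ hj, h2]
    simp only at hb
    omega
  · obtain ⟨j, hj, -, h2, h3⟩ := exists_openRequest ρ t c q hq q.2 (Or.inr rfl)
    refine ⟨j, hj, fun i h4 h5 => h3 i h4 (by omega), ?_⟩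
    rw [infixWeight_succ _ _ hj, h2]
    simp only at hb
    omega

/-- As long as there are no overflows, the memory covers the accumulated weights of unanswered
requests. -/
theorem requestRun_covers {ρ : ℕ → V} {N j : ℕ} (hN : ∀ t ≥ N, ¬ G.OverflowAt b ρ t) (hj : N ≤ j)
    (c : G.oddColors) (hc : G.color (ρ j) = c) (i : ℕ)
    (ha : ∀ k, j ≤ k → k ≤ j + i → G.color (ρ k) ∉ answer c) :
    ∃ p, (G.requestRun b ρ (j + i)).1 c = some p ∧
      p.1 ≤ infixWeight G.weight ρ j (j + i) ∧ infixWeight G.weight ρ j (j + i) ≤ p.2 := by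
  induction i with
  | zero =>
    rw [add_zero, infixWeight_self]
    have hodd : Odd (G.color (ρ j)) := hc ▸ c.2.1
    cases j with
    | zero => exact ⟨(0, 0), by simp [requestRun, initRequest, hc, c.2.1], le_rfl, le_rfl⟩
    | succ j =>
      rw [requestRun_succ]
      simp only [requestStep, if_neg (Nat.not_even_iff_odd.2 hodd), if_pos hc.symm]
      refine ⟨_, rfl, ?_⟩
      cases G.overflowStep b (G.weightStep (G.weight (ρ j) (ρ (j + 1)))
        (G.requestRun b ρ j).1) c <;> simp [openRequest]
  | succ i ih =>
    obtain ⟨p, hp, h1, h2⟩ := ih fun k h1 h2 => ha k h1 (by omega)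
    have hn := ha (j + i + 1) (by omega) (by omega)
    rw [← add_assoc, infixWeight_succ _ _ (Nat.le_add_right j i), requestRun_succ,
      overflowStep_of_not_overflows (hN (j + i) (by omega))]
    simp only [requestStep, weightStep, hp, Option.map_some]
    split_ifs with he h3 h3
    · exact absurd ⟨h3, he⟩ hn
    · exact ⟨_, rfl, by simpa using h1, by simpa using h2⟩
    · refine ⟨_, rfl, ?_⟩
      simp only [openRequest]
      omega
    · exact ⟨_, rfl, by simpa using h1, by simpa using h2⟩

/-- Up to its first answer the request stays open, so its weight lies in an interval that never
leaves `[-b, b]`. -/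
theorem costOfResponse_le_of_not_overflowAt {ρ : ℕ → V} {N j : ℕ}
    (hN : ∀ t ≥ N, ¬ G.OverflowAt b ρ t) (hj : N ≤ j)
    (h : Odd (G.color (ρ j)) → ∃ j', j ≤ j' ∧ G.color (ρ j') ∈ answer (G.color (ρ j))) :
    costOfResponse G.color G.weight ρ j ≤ b := by
  classical
  by_cases ho : Odd (G.color (ρ j))
  · have hex := h ho
    obtain ⟨h1, h2⟩ := Nat.find_spec hex
    set j' := Nat.find hex with hj'
    have hmin : ∀ k, j ≤ k → k < j' → G.color (ρ k) ∉ answer (G.color (ρ j)) :=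
      fun k hk hlt hmem => Nat.find_min hex hlt ⟨hk, hmem⟩
    refine costOfResponse_le h1 h2 fun k hk1 hk2 => ?_
    obtain ⟨i, rfl⟩ := Nat.exists_eq_add_of_le hk1
    cases i with
    | zero => simp [infixWeight_self]
    | succ i =>
      let c : G.oddColors := ⟨G.color (ρ j), ho, ρ j, rfl⟩
      -- The interval is taken one position earlier and shifted by the last edge weight. The
      -- overflow test precedes the request step, so this also covers the answering position, where
      -- the interval is deleted.
      obtain ⟨p, hp, h3, h4⟩ := requestRun_covers hN hj c rfl i
        fun k hk1 hk2 => hmin k hk1 (by omega)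
      have hb : ¬ (p.1 + G.weight (ρ (j + i)) (ρ (j + i + 1)) < -(b : ℤ) ∨
          (b : ℤ) < p.2 + G.weight (ρ (j + i)) (ρ (j + i + 1))) := fun hb =>
        hN (j + i) (by omega) ⟨c, _, by simp only [weightStep, hp, Option.map_some]; rfl, hb⟩
      rw [← add_assoc, infixWeight_succ _ _ (Nat.le_add_right j i)]
      omega
  · refine costOfResponse_le le_rfl ⟨le_rfl, Nat.not_odd_iff_even.1 ho⟩ fun k h1 h2 => ?_
    obtain rfl := le_antisymm h2 h1
    simp [infixWeight_self]

/-! ### Winning with few overflows -/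

variable (G b)

/-- The vertices from which Player `0` can ensure the parity condition with less than `k`
overflows. -/
def region (k : ℕ) : Set V :=
  {u | ∃ σ : Strategy G.arena 0, ∀ ρ : ℕ → V, G.arena.IsPlay ρ → ρ 0 = u → σ.Consistent ρ →
    ρ ∈ parity G.color ∧ {t | G.OverflowAt b ρ t}.encard < k}

variable {G b}

theorem region_mono {k l : ℕ} (h : k ≤ l) : G.region b k ⊆ G.region b l := by
  rintro u ⟨σ, hσ⟩
  exact ⟨σ, fun ρ h1 h2 h3 => ⟨(hσ ρ h1 h2 h3).1,
    (hσ ρ h1 h2 h3).2.trans_le (by exact_mod_cast h)⟩⟩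

/-- Since the memory restarts at `t + 1`, later overflows are exactly those of the suffix. -/
theorem encard_overflowAt_le {ρ : ℕ → V} {t : ℕ} (ht : G.OverflowAt b ρ t)
    (hmin : ∀ s < t, ¬ G.OverflowAt b ρ s) :
    {s | G.OverflowAt b ρ s}.encard ≤
      {s | G.OverflowAt b (fun i => ρ (t + 1 + i)) s}.encard + 1 := by
  have hsub : {s | G.OverflowAt b ρ s} ⊆
      insert t ((fun s => t + 1 + s) '' {s | G.OverflowAt b (fun i => ρ (t + 1 + i)) s}) := by
    intro s hs
    rcases lt_trichotomy s t with h | rfl | h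
    · exact absurd hs (hmin s h)
    · exact Set.mem_insert _ _
    · obtain ⟨i, rfl⟩ := Nat.exists_eq_add_of_le (Nat.succ_le_of_lt h)
      exact Set.mem_insert_of_mem _ ⟨i, (overflowAt_shift ht i).2 hs, rfl⟩
  refine (Set.encard_le_encard hsub).trans ((Set.encard_insert_le _ _).trans ?_)
  exact add_le_add_left (Set.encard_image_le _ _) 1

open Classical in
/-- Play `σ` until the first overflow, then the strategy that `τ` assigns to the vertex reached. -/
noncomputable def switchStrategy (b : ℕ) (σ : Strategy G.arena 0) (τ : V → Strategy G.arena 0) :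
    Strategy G.arena 0 where
  move w v :=
    if h : ∃ t < w.length, G.OverflowAt b (fun i => w.getD i v) t then
      (τ (w.getD (Nat.find h + 1) v)).move (w.drop (Nat.find h + 1)) v
    else σ.move w v
  edge_move w v hv := by
    split_ifs with h
    · exact (τ _).edge_move _ _ hv
    · exact σ.edge_move _ _ hv

theorem overflowAt_getD_iff (ρ : ℕ → V) {j t : ℕ} (h : t < j) :
    G.OverflowAt b (fun i => ((List.range j).map ρ).getD i (ρ j)) t ↔ G.OverflowAt b ρ t :=
  overflowAt_congr fun _ hi => getD_map_range ρ (hi.trans h)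

theorem switchStrategy_move_of_forall_not (σ : Strategy G.arena 0) (τ : V → Strategy G.arena 0)
    {ρ : ℕ → V} {j : ℕ} (h : ∀ t < j, ¬ G.OverflowAt b ρ t) :
    (switchStrategy b σ τ).move ((List.range j).map ρ) (ρ j) =
      σ.move ((List.range j).map ρ) (ρ j) := by
  simp only [switchStrategy]
  rw [dif_neg]
  rintro ⟨t, ht, h'⟩
  rw [List.length_map, List.length_range] at ht
  exact h t ht ((overflowAt_getD_iff ρ ht).1 h')

theorem switchStrategy_move_of_overflowAt (σ : Strategy G.arena 0) (τ : V → Strategy G.arena 0)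
    {ρ : ℕ → V} {t : ℕ} (ht : G.OverflowAt b ρ t) (hmin : ∀ s < t, ¬ G.OverflowAt b ρ s) (i : ℕ) :
    (switchStrategy b σ τ).move ((List.range (t + 1 + i)).map ρ) (ρ (t + 1 + i)) =
      (τ (ρ (t + 1))).move ((List.range i).map fun i => ρ (t + 1 + i)) (ρ (t + 1 + i)) := by
  classical
  have h : ∃ s < ((List.range (t + 1 + i)).map ρ).length,
      G.OverflowAt b (fun k => ((List.range (t + 1 + i)).map ρ).getD k (ρ (t + 1 + i))) s :=
    ⟨t, by simp only [List.length_map, List.length_range]; omega,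
      (overflowAt_getD_iff ρ (by omega)).2 ht⟩
  have hfind : Nat.find h = t := by
    rw [Nat.find_eq_iff]
    refine ⟨⟨by simp only [List.length_map, List.length_range]; omega,
      (overflowAt_getD_iff ρ (by omega)).2 ht⟩, fun s hs hs' => hmin s hs ?_⟩
    exact (overflowAt_getD_iff ρ (by omega)).1 hs'.2
  have hdrop : ((List.range (t + 1 + i)).map ρ).drop (t + 1) =
      (List.range i).map fun i => ρ (t + 1 + i) := by
    rw [List.range_add, List.map_append, List.drop_left' (by simp), List.map_map]
    rfl
  simp only [switchStrategy]
  rw [dif_pos h]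
  -- A variable in place of `Nat.find h` allows substitution in all its occurrences at once.
  have hc : ∀ n, n = t →
      (τ (((List.range (t + 1 + i)).map ρ).getD (n + 1) (ρ (t + 1 + i)))).move
        (((List.range (t + 1 + i)).map ρ).drop (n + 1)) (ρ (t + 1 + i)) =
      (τ (ρ (t + 1))).move ((List.range i).map fun i => ρ (t + 1 + i)) (ρ (t + 1 + i)) := by
    rintro n rfl
    rw [getD_map_range ρ (Nat.le_add_right _ _), hdrop]
  exact hc _ (by convert hfind)

/-- If a strategy ensures the parity condition and that the first overflow, if any, leads to a
vertex from which Player `0` wins with less than `k` overflows, then he wins with less than `k + 1`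
overflows. -/
theorem mem_region_succ {k : ℕ} {u : V} (σ : Strategy G.arena 0)
    (hσ : ∀ ρ : ℕ → V, G.arena.IsPlay ρ → ρ 0 = u → σ.Consistent ρ → ρ ∈ parity G.color ∧
      ∀ t, G.OverflowAt b ρ t → (∀ s < t, ¬ G.OverflowAt b ρ s) → ρ (t + 1) ∈ G.region b k) :
    u ∈ G.region b (k + 1) := by
  classical
  have hτ : ∀ x, ∃ τ : Strategy G.arena 0, x ∈ G.region b k → ∀ ρ : ℕ → V, G.arena.IsPlay ρ →
      ρ 0 = x → τ.Consistent ρ →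
      ρ ∈ parity G.color ∧ {t | G.OverflowAt b ρ t}.encard < k := by
    intro x
    by_cases hx : x ∈ G.region b k
    · obtain ⟨τ, h⟩ := hx
      exact ⟨τ, fun _ => h⟩
    · exact ⟨σ, fun h => absurd h hx⟩
  choose τ hτ using hτ
  refine ⟨switchStrategy b σ τ, fun ρ hp h0 hc => ?_⟩
  by_cases hex : ∃ t, G.OverflowAt b ρ t
  · obtain ⟨t, ht, hmin⟩ : ∃ t, G.OverflowAt b ρ t ∧ ∀ s < t, ¬ G.OverflowAt b ρ s :=
      ⟨Nat.find hex, Nat.find_spec hex, fun s hs => Nat.find_min hex hs⟩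
    -- `ρ` is known to follow `σ` only up to the first overflow, so the hypothesis is applied to an
    -- extension of that prefix.
    obtain ⟨π, hπ, hπc, hπρ⟩ := σ.exists_extension (ρ := ρ) (m := t + 1) (fun j _ => hp j)
      fun j hj hj' => (hc j hj').trans
        (switchStrategy_move_of_forall_not σ τ fun s hs => hmin s (by omega))
    have hiff : ∀ s ≤ t, (G.OverflowAt b π s ↔ G.OverflowAt b ρ s) := fun s hs =>
      overflowAt_congr fun i hi => hπρ i (by omega)
    have hmem := (hσ π hπ ((hπρ 0 (by omega)).trans h0) hπc).2 t ((hiff t le_rfl).2 ht)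
      fun s hs h => hmin s hs ((hiff s hs.le).1 h)
    rw [hπρ _ le_rfl] at hmem
    obtain ⟨h1, h2⟩ := hτ _ hmem (fun i => ρ (t + 1 + i)) (fun i => hp (t + 1 + i)) rfl
      fun i hi => (hc (t + 1 + i) hi).trans (switchStrategy_move_of_overflowAt σ τ ht hmin i)
    refine ⟨(parity_shift_iff _ _ _).1 h1, (encard_overflowAt_le ht hmin).trans_lt ?_⟩
    push_cast
    exact (ENat.add_lt_add_iff_right (by simp)).2 h2
  · push Not at hex
    refine ⟨(hσ ρ hp h0 fun j hj => (hc j hj).trans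
      (switchStrategy_move_of_forall_not σ τ fun s _ => hex s)).1, ?_⟩
    have : {t | G.OverflowAt b ρ t} = ∅ := Set.eq_empty_of_forall_notMem hex
    rw [this, Set.encard_empty]
    exact_mod_cast k.succ_pos

theorem region_stabilizes (G : ParityGameWithWeights V) (b : ℕ) :
    G.region b (Nat.card V) = Set.univ ∨
      ∃ k < Nat.card V, G.region b (k + 1) = G.region b k := by
  have := G.arena.finite
  by_cases h : ∃ k < Nat.card V, G.region b (k + 1) = G.region b k
  · exact Or.inr h
  push Not at h
  left
  -- Every strict inclusion contributes at least one new vertex.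
  have key : ∀ k ≤ Nat.card V, k ≤ (G.region b k).ncard := by
    intro k
    induction k with
    | zero => simp
    | succ k ih =>
      intro hk
      refine Nat.succ_le_of_lt ((ih (by omega)).trans_lt (Set.ncard_lt_ncard ?_ (Set.toFinite _)))
      exact (region_mono k.le_succ).ssubset_of_ne (h k hk).symm
  exact Set.eq_of_subset_of_ncard_le (Set.subset_univ _) (by simpa using key _ le_rfl)
    (Set.toFinite _)

/-! ### Plays with infinitely many overflows -/

theorem le_cost {v : V} {σ : Strategy G.arena 0} (hσ : G.cost v σ ≤ b) {ρ : ℕ → V}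
    (hp : G.arena.IsPlay ρ) (h0 : ρ 0 = v) (hc : σ.Consistent ρ) :
    ∀ᶠ j in atTop, costOfResponse G.color G.weight ρ j ≤ b :=
  eventually_costOfResponse_le ((le_iSup₂ (f := fun (ρ : ℕ → V)
    (_ : G.arena.IsPlay ρ ∧ ρ 0 = v ∧ σ.Consistent ρ) =>
      limsup (fun j => costOfResponse G.color G.weight ρ j) atTop) ρ ⟨hp, h0, hc⟩).trans hσ)

theorem mem_parity_of_costOfResponse_le {ρ : ℕ → V}
    (h : ∀ᶠ j in atTop, costOfResponse G.color G.weight ρ j ≤ b) : ρ ∈ parity G.color := by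
  filter_upwards [h] with j hj _
  exact exists_answer_of_costOfResponse_lt_top (hj.trans_lt (ENat.natCast_lt_top b))

/-- A stage in the construction of a play with infinitely many overflows: a play that is
consistent with `σ` and a position at which it visits a vertex outside of `X`. -/
structure Stage (v : V) (σ : Strategy G.arena 0) (X : Set V) where
  play : ℕ → V
  pos : ℕ
  isPlay : G.arena.IsPlay play
  start : play 0 = v
  consistent : σ.Consistent play
  notMem : play pos ∉ X

/-- Otherwise the residual of `σ` would meet the hypotheses of `mem_region_succ` at the current
vertex, which by stability would lie in the region. The parity part is inherited from the bounded
cost of the spliced play. -/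
theorem Stage.exists_next {v : V} {σ : Strategy G.arena 0} (hσ : G.cost v σ ≤ b) {k : ℕ}
    (hk : G.region b (k + 1) = G.region b k) (s : Stage v σ (G.region b k)) :
    ∃ s' : Stage v σ (G.region b k), (∀ i ≤ s.pos, s'.play i = s.play i) ∧
      ∃ t, s'.pos = s.pos + t + 1 ∧ G.OverflowAt b (fun i => s'.play (s.pos + i)) t := by
  by_contra hcon
  refine s.notMem (hk.subset (mem_region_succ (σ.residual ((List.range s.pos).map s.play))
    fun π hπ h0 hc => ?_))
  have hp' := isPlay_splice h0 (fun j _ => s.isPlay j) hπ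
  have hc' := consistent_splice (σ := σ) h0 (fun j _ => s.consistent j) hc
  have h0' := (splice_of_le h0 (Nat.zero_le s.pos)).trans s.start
  have hshift : (fun i => splice s.play s.pos π (s.pos + i)) = π :=
    funext fun i => splice_add _ _ _ _
  constructor
  · have h := mem_parity_of_costOfResponse_le (le_cost hσ hp' h0' hc')
    rwa [← parity_shift_iff _ _ s.pos, hshift] at h
  · intro t ht _
    by_contra hn
    refine hcon ⟨⟨splice s.play s.pos π, s.pos + t + 1, hp', h0', hc', ?_⟩,
      fun i hi => splice_of_le h0 hi, t, rfl, ?_⟩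
    · rwa [add_assoc, splice_add]
    · simpa only [hshift] using ht

theorem mem_region_of_stable {v : V} {σ : Strategy G.arena 0} (hσ : G.cost v σ ≤ b) {k : ℕ}
    (hk : G.region b (k + 1) = G.region b k) : v ∈ G.region b k := by
  by_contra hv
  choose next hnext t ht hov using Stage.exists_next hσ hk
  obtain ⟨π, h1, h2, h3⟩ := σ.exists_consistent v
  let S : ℕ → Stage v σ (G.region b k) :=
    fun i => Nat.rec ⟨π, 0, h1, h2, h3, by rwa [h2]⟩ (fun _ s => next s) i
  have hS : ∀ i, S (i + 1) = next (S i) := fun _ => rfl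
  have hpos : ∀ i, i ≤ (S i).pos := by
    intro i
    induction i with
    | zero => exact Nat.zero_le _
    | succ i ih =>
      rw [hS, ht]
      omega
  have hposmono : Monotone fun i => (S i).pos :=
    monotone_nat_of_le_succ fun i => by
      change _ ≤ (S (i + 1)).pos
      rw [hS, ht]
      omega
  have hagree : ∀ i n l, l ≤ (S i).pos → (S (i + n)).play l = (S i).play l := by
    intro i n l hl
    induction n with
    | zero => rfl
    | succ n ih =>
      rw [← add_assoc, hS, hnext _ l (hl.trans (hposmono (Nat.le_add_right i n))), ih]
  -- The limit play: stage `l` has position at least `l`, so later stages no longer change entry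
  -- `l`.
  let ρ : ℕ → V := fun l => (S l).play l
  have hρ : ∀ i l, l ≤ (S i).pos → ρ l = (S i).play l := by
    intro i l hl
    rcases le_total i l with h | h
    · obtain ⟨n, rfl⟩ := Nat.exists_eq_add_of_le h
      exact hagree i n _ hl
    · obtain ⟨n, rfl⟩ := Nat.exists_eq_add_of_le h
      exact (hagree l n _ (hpos l)).symm
  have hp : G.arena.IsPlay ρ := fun j => by
    rw [hρ (j + 1) j (by have := hpos (j + 1); omega), hρ (j + 1) (j + 1) (hpos _)]
    exact (S (j + 1)).isPlay j
  have hc : σ.Consistent ρ := fun j => by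
    have hle : ∀ i ≤ j + 1, ρ i = (S (j + 1)).play i := fun i hi =>
      hρ (j + 1) i (hi.trans (hpos (j + 1)))
    rw [hle j j.le_succ, hle (j + 1) le_rfl, map_range_congr fun i hi => hle i (by omega)]
    exact (S (j + 1)).consistent j
  obtain ⟨N, hN⟩ := eventually_atTop.1 (le_cost hσ hp ((S 0).start) hc)
  -- The memory is restarted at `(S N).pos ≥ N`, so the offending request lies beyond `N`, where
  -- costs are already bounded.
  have hovρ : G.OverflowAt b (fun i => ρ ((S N).pos + i)) (t (S N)) := by
    refine (overflowAt_congr fun i hi => ?_).1 (hov (S N))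
    refine (hρ (N + 1) _ ?_).symm
    rw [hS, ht]
    omega
  obtain ⟨j, hj, ha, hb⟩ := exists_lt_costOfResponse hovρ
  rw [infixWeight_shift] at hb
  refine not_lt.2 (hN ((S N).pos + j) (by have := hpos N; omega))
    (lt_costOfResponse (by omega) (fun i h4 h5 => ?_) hb)
  obtain ⟨l, rfl⟩ := Nat.exists_eq_add_of_le ((Nat.le_add_right (S N).pos j).trans h4)
  exact ha l (by omega) (by omega)

theorem mem_region_card {v : V} {σ : Strategy G.arena 0} (hσ : G.cost v σ ≤ b) :
    v ∈ G.region b (Nat.card V) := by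
  rcases region_stabilizes G b with h | ⟨k, hk, h⟩
  · rw [h]
    trivial
  · exact region_mono hk.le (mem_region_of_stable hσ h)

/-! ### The threshold game -/

theorem upd_fst_of_overflows {m : G.Memory b} {v v' : V}
    (h : G.Overflows b (G.weightStep (G.weight v v') m.2.1)) :
    ((G.upd b m v v').1 : ℕ) = min ((m.1 : ℕ) + 1) (Nat.card V) := by
  simp only [upd, if_pos h]

theorem upd_fst_of_not_overflows {m : G.Memory b} {v v' : V}
    (h : ¬ G.Overflows b (G.weightStep (G.weight v v') m.2.1)) :
    (G.upd b m v v').1 = m.1 := by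
  simp only [upd, if_neg h]

theorem memoryRun_fst_of_overflowAt {ρ : ℕ → V} {t : ℕ} (h : G.OverflowAt b ρ t) :
    ((G.memoryRun b ρ (t + 1)).1 : ℕ) = min (((G.memoryRun b ρ t).1 : ℕ) + 1) (Nat.card V) :=
  upd_fst_of_overflows (by rw [memoryRun_snd]; exact h)

theorem memoryRun_fst_of_not_overflowAt {ρ : ℕ → V} {t : ℕ} (h : ¬ G.OverflowAt b ρ t) :
    (G.memoryRun b ρ (t + 1)).1 = (G.memoryRun b ρ t).1 :=
  upd_fst_of_not_overflows (by rw [memoryRun_snd]; exact h)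

theorem memoryRun_fst_le_succ (ρ : ℕ → V) (t : ℕ) :
    (G.memoryRun b ρ t).1 ≤ (G.memoryRun b ρ (t + 1)).1 := by
  by_cases h : G.OverflowAt b ρ t
  · rw [Fin.le_def, memoryRun_fst_of_overflowAt h]
    have := (G.memoryRun b ρ t).1.2
    omega
  · rw [memoryRun_fst_of_not_overflowAt h]

theorem memoryRun_fst_le_encard (ρ : ℕ → V) (j : ℕ) :
    ((G.memoryRun b ρ j).1 : ℕ) ≤ {t | G.OverflowAt b ρ t ∧ t < j}.encard := by
  induction j with
  | zero => simp [memoryRun, init]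
  | succ j ih =>
    by_cases h : G.OverflowAt b ρ j
    · have hins : insert j {t | G.OverflowAt b ρ t ∧ t < j} ⊆
          {t | G.OverflowAt b ρ t ∧ t < j + 1} := by
        rintro t (rfl | ⟨h1, h2⟩)
        · exact ⟨h, Nat.lt_succ_self _⟩
        · exact ⟨h1, h2.trans (Nat.lt_succ_self _)⟩
      refine le_trans ?_ (Set.encard_le_encard hins)
      rw [Set.encard_insert_of_notMem (fun h => lt_irrefl _ h.2), memoryRun_fst_of_overflowAt h]
      refine le_trans ?_ (add_le_add_left ih 1)
      exact_mod_cast min_le_left _ (Nat.card V)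
    · rw [memoryRun_fst_of_not_overflowAt h]
      exact ih.trans (Set.encard_le_encard fun t ht => ⟨ht.1, ht.2.trans (Nat.lt_succ_self _)⟩)

/-- In a play of the threshold game, the memory component is the run of the memory structure on
the vertex component. -/
theorem snd_eq_memoryRun {π : ℕ → V × G.Memory b} {v : V} (hp : (G.thresholdArena b).IsPlay π)
    (h0 : π 0 = (v, G.init b v)) (j : ℕ) :
    (π j).2 = G.memoryRun b (fun i => (π i).1) j := by
  induction j with
  | zero => simp [memoryRun, h0]
  | succ j ih => rw [← (hp j).2, ih]; rfl

theorem wins_of_mem_region {v : V} (h : v ∈ G.region b (Nat.card V)) :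
    (G.thresholdGame b).Wins 0 (v, G.init b v) := by
  obtain ⟨σ, hσ⟩ := h
  let σ' : Strategy (G.thresholdGame b).arena 0 :=
    { move := fun w x => (σ.move (w.map Prod.fst) x.1,
        G.upd b x.2 x.1 (σ.move (w.map Prod.fst) x.1))
      edge_move := fun w x hx => ⟨σ.edge_move _ _ hx, rfl⟩ }
  refine ⟨σ', fun π hp h0 hc => ?_⟩
  obtain ⟨h1, h2⟩ := hσ (fun i => (π i).1) (fun j => (hp j).1) (by simp [h0]) fun j hj => by
    have := congrArg Prod.fst (hc j hj)
    simpa only [σ', List.map_map, Function.comp_def] using this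
  have hcol : ∀ j, G.thresholdColor b (π j) = G.color (π j).1 := fun j => by
    refine if_pos ?_
    rw [snd_eq_memoryRun hp h0]
    have h3 := (memoryRun_fst_le_encard (G := G) (b := b) (fun i => (π i).1) j).trans_lt
      ((Set.encard_le_encard fun t ht => ht.1).trans_lt h2)
    exact_mod_cast h3
  simp only [parity, Set.mem_ofPred_eq] at h1
  simpa only [Game.winFor, if_pos, thresholdGame, parity, Set.mem_ofPred_eq, hcol] using h1

theorem cost_le_of_wins {v : V} (h : (G.thresholdGame b).Wins 0 (v, G.init b v)) :
    ∃ σ : Strategy G.arena 0, G.cost v σ ≤ b := by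
  obtain ⟨σ', hσ'⟩ := h
  let lift : (ℕ → V) → ℕ → V × G.Memory b := fun ρ j => (ρ j, G.memoryRun b ρ j)
  have hlift : ∀ {ρ ρ' : ℕ → V} {j : ℕ}, (∀ i ≤ j, ρ i = ρ' i) → lift ρ j = lift ρ' j :=
    fun h => Prod.ext (h _ le_rfl) (memoryRun_congr h)
  -- The memory states are functions of the visited vertices, so a history in `G` determines the one
  -- fed to `σ'`.
  let σ : Strategy G.arena 0 :=
    { move := fun w v => (σ'.move ((List.range w.length).map (lift fun i => w.getD i v))
        (v, G.memoryRun b (fun i => w.getD i v) w.length)).1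
      edge_move := fun w v hv => (σ'.edge_move
        ((List.range w.length).map (lift fun i => w.getD i v))
        (v, G.memoryRun b (fun i => w.getD i v) w.length) hv).1 }
  refine ⟨σ, iSup₂_le fun ρ ⟨hp, h0, hc⟩ => ?_⟩
  have hp' : (G.thresholdGame b).arena.IsPlay (lift ρ) := fun j => ⟨hp j, rfl⟩
  have hc' : σ'.Consistent (lift ρ) := fun j hj => by
    have hg : ∀ i ≤ j, ((List.range j).map ρ).getD i (ρ j) = ρ i :=
      fun i hi => getD_map_range ρ hi
    have hmove : ρ (j + 1) = (σ'.move ((List.range j).map (lift ρ)) (lift ρ j)).1 := by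
      rw [hc j hj]
      simp only [σ, List.length_map, List.length_range]
      rw [map_range_congr fun i hi => hlift fun l hl => hg l (hl.trans hi.le),
        memoryRun_congr hg]
    refine Prod.ext hmove ?_
    rw [← (σ'.edge_move ((List.range j).map (lift ρ)) (lift ρ j) hj).2, ← hmove]
    rfl
  have hwin : lift ρ ∈ parity (G.thresholdColor b) := by
    have h := hσ' (lift ρ) hp' (by simp only [lift, h0, memoryRun]) hc'
    simpa only [Game.winFor, if_pos, thresholdGame] using h
  obtain ⟨N, hN⟩ := eventually_atTop.1 hwin
  have hmono : Monotone fun j => (G.memoryRun b ρ j).1 :=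
    monotone_nat_of_le_succ (memoryRun_fst_le_succ ρ)
  -- Once saturated, the counter stays so, and requests for color `1` are never answered.
  have hlt : ∀ j, ((G.memoryRun b ρ j).1 : ℕ) < Nat.card V := by
    intro j
    by_contra hj
    have hcol : ∀ k ≥ j, G.thresholdColor b (lift ρ k) = 1 := fun k hk =>
      if_neg fun hk' => hj (lt_of_le_of_lt (Fin.le_def.1 (hmono hk)) hk')
    obtain ⟨j', h1, h2⟩ := hN (max N j) (le_max_left _ _)
      (by rw [hcol _ (le_max_right _ _)]; exact odd_one)
    rw [hcol j' ((le_max_right _ _).trans h1)] at h2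
    exact absurd h2.2 (by decide)
  have hcol : ∀ j, G.thresholdColor b (lift ρ j) = G.color (ρ j) := fun j => if_pos (hlt j)
  -- The monotone counter stabilizes, and below `n` each overflow would increase it.
  obtain ⟨M, hM⟩ : ∃ M, ∀ t ≥ M, ¬ G.OverflowAt b ρ t := by
    obtain ⟨M, hM⟩ := WellFoundedGT.monotone_chain_condition ⟨_, hmono⟩
    refine ⟨M, fun t ht ho => ?_⟩
    have h1 := memoryRun_fst_of_overflowAt ho
    have h2 : (G.memoryRun b ρ M).1 = (G.memoryRun b ρ t).1 := hM t ht
    have h3 : (G.memoryRun b ρ M).1 = (G.memoryRun b ρ (t + 1)).1 := hM (t + 1) (by omega)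
    rw [← h3, h2] at h1
    have := hlt t
    omega
  refine limsup_le_of_le (h := eventually_atTop.2 ⟨max N M, fun j hj => ?_⟩)
  have h := hN j ((le_max_left _ _).trans hj)
  simp only [hcol] at h
  exact costOfResponse_le_of_not_overflowAt hM ((le_max_right _ _).trans hj) h

end ParityGameWithWeights

end WeightedParity

theorem mainTheorem7 {V : Type*} (G : WeightedParity.ParityGameWithWeights V) (b : ℕ) (v : V) :
    (∃ σ : WeightedParity.Strategy G.arena 0, G.cost v σ ≤ (b : ℕ∞)) ↔
      (G.thresholdGame b).Wins 0 (v, G.init b v) :=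
  ⟨fun ⟨_, hσ⟩ => WeightedParity.ParityGameWithWeights.wins_of_mem_region
      (WeightedParity.ParityGameWithWeights.mem_region_card hσ),
    WeightedParity.ParityGameWithWeights.cost_le_of_wins⟩
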